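/- Let $H,K$ be complex Hilbert spaces, let $M\subseteq B(H)$ and $D\subseteq B(K)$ be von Neumann algebras, and give them their weak* topologies as dual spaces (equivalently, their $\sigma$-weak topologies). A linear functional or linear map is called normal if it is weak* continuous; a state is a contractive unital linear functional; and a linear map is positive if it sends positive operators to positive operators. Let $A$ be a weak* closed subalgebra of $M$ containing the unit of $M$, with the weak* topology inherited from $M$, and let $\Phi:A\to D$ be a unital, weak* continuous, contractive linear map. Suppose that for every normal state $\varphi$ on $D$ there is exactly one normal state $\psi$ on $M$ with $\psi|_A=\varphi\circ\Phi$. Then there is exactly one normal positive linear map $\Psi:M\to D$ with $\Psi|_A=\Phi$. -/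

import Mathlib

open scoped Topology

namespace VonNeumannAlgebra

/-- The weak* topology of `B(H)` as the dual of the trace class operators (the `σ`-weak, or
ultraweak, topology): the coarsest topology that makes every functional
`x ↦ ∑ₙ ⟨x ξₙ, ηₙ⟩` with `∑ₙ ‖ξₙ‖² < ∞` and `∑ₙ ‖ηₙ‖² < ∞` continuous.
(Mathlib's inner product is linear in its second argument.) -/
@[reducible] noncomputable def ultraweakTopology (H : Type*) [NormedAddCommGroup H] [InnerProductSpace ℂ H]
    [CompleteSpace H] : TopologicalSpace (H →L[ℂ] H) :=
  ⨅ p : {p : (ℕ → H) × (ℕ → H) //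
      Summable (fun n => ‖p.1 n‖ ^ 2) ∧ Summable (fun n => ‖p.2 n‖ ^ 2)},
    TopologicalSpace.induced
      (fun x : H →L[ℂ] H => ∑' n, inner ℂ (p.1.2 n) (x (p.1.1 n))) inferInstance

variable {H : Type*} [NormedAddCommGroup H] [InnerProductSpace ℂ H] [CompleteSpace H]
variable {K : Type*} [NormedAddCommGroup K] [InnerProductSpace ℂ K] [CompleteSpace K]

/-- The weak* topology of a von Neumann algebra `M` on `H`, i.e. the restriction to `M` of the
weak* topology of `B(H)`. -/
@[reducible] noncomputable def weakStar (M : VonNeumannAlgebra H) : TopologicalSpace M.toStarSubalgebra :=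
  TopologicalSpace.induced (fun x => (x : H →L[ℂ] H)) (ultraweakTopology H)

/-- The weak* topology of a subalgebra `A` of a von Neumann algebra `M`, i.e. the restriction
to `A` of the weak* topology of `M`. -/
@[reducible] noncomputable def weakStarOn (M : VonNeumannAlgebra H) (A : Subalgebra ℂ M.toStarSubalgebra) :
    TopologicalSpace A :=
  TopologicalSpace.induced (fun a => (a : M.toStarSubalgebra)) M.weakStar

/-- A normal state on `M`: a weak* continuous, contractive, unital linear functional. -/
structure IsNormalState (M : VonNeumannAlgebra H) (φ : M.toStarSubalgebra →ₗ[ℂ] ℂ) : Prop where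
  map_one : φ 1 = 1
  contractive : ∀ x : M.toStarSubalgebra, ‖φ x‖ ≤ ‖(x : H →L[ℂ] H)‖
  continuous : Continuous[M.weakStar, inferInstance] φ

/-- A normal positive linear map `M → D`: a weak* continuous linear map that sends positive
operators to positive operators. -/
structure IsNormalPositive (M : VonNeumannAlgebra H) (D : VonNeumannAlgebra K)
    (Ψ : M.toStarSubalgebra →ₗ[ℂ] D.toStarSubalgebra) : Prop where
  positive : ∀ x : M.toStarSubalgebra,
    (x : H →L[ℂ] H).IsPositive → (Ψ x : K →L[ℂ] K).IsPositive
  continuous : Continuous[M.weakStar, D.weakStar] Ψ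

end VonNeumannAlgebra

/-! Rescaling states shows that every normal positive functional `f` on `D` has exactly one normal
positive `g` on `M` with `g = f ∘ Φ` on `A`. By uniqueness `f ↦ g` respects sums and nonnegative
multiples, and it extends complex-linearly: the span of all pairs `(f, g)` is the graph of a map
(`eq_zero_of_mem_extensionGraph`). The desired `Ψ` is the dual of this map. Polarization puts every
vector functional of `D` in its domain, so the extensions form a sesquilinear form on `K`, bounded
because a positive functional has norm equal to its value at `1`. This form defines operators `Ψ x`
(`exists_linearMap_of_form`), which lie in the bicommutant of `D` (`exists_dual_map`). Positivity of
`Ψ` is inherited from the diagonal of the form. Normality requires infinite sums of vector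
functionals; there the tails are controlled in norm (`hasSum_of_sumFunctional_extension`).
Conversely, any normal positive extension of `Φ` pulls vector functionals back to these same
extensions, which gives uniqueness. -/

namespace VonNeumannAlgebra

variable {H : Type*} [NormedAddCommGroup H] [InnerProductSpace ℂ H] [CompleteSpace H]
variable {K : Type*} [NormedAddCommGroup K] [InnerProductSpace ℂ K] [CompleteSpace K]

/-! ### Normal positive functionals -/

/-- A weak* continuous functional `f` on `M` with `‖f‖ ≤ f 1`: a nonnegative multiple of a normal
state, or zero. -/
structure IsNormalPositiveFunctional (M : VonNeumannAlgebra H)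
    (f : M.toStarSubalgebra →ₗ[ℂ] ℂ) : Prop where
  exists_bound : ∃ c : ℝ, f 1 = c ∧ ∀ x : M.toStarSubalgebra, ‖f x‖ ≤ c * ‖(x : H →L[ℂ] H)‖
  continuous : Continuous[M.weakStar, inferInstance] f

/-- The C*-identity: the cross terms of `(x + it)* (x + it)` cancel for self-adjoint `x`. -/
theorem norm_add_I_smul_sq_le {x : H →L[ℂ] H} (hx : IsSelfAdjoint x) (t : ℝ) :
    ‖x + ((t : ℂ) * Complex.I) • (1 : H →L[ℂ] H)‖ ^ 2 ≤ ‖x‖ ^ 2 + t ^ 2 := by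
  have h : star (x + ((t : ℂ) * Complex.I) • (1 : H →L[ℂ] H)) *
      (x + ((t : ℂ) * Complex.I) • (1 : H →L[ℂ] H)) =
      star x * x + ((t : ℂ) ^ 2) • (1 : H →L[ℂ] H) := by
    have : (star ((t : ℂ) * Complex.I)) = -((t : ℂ) * Complex.I) := by simp
    rw [star_add, star_smul, this, star_one, hx.star_eq]
    simp only [mul_add, add_mul, smul_mul_assoc, mul_smul_comm, mul_one, one_mul,
      neg_smul, neg_mul]
    have h2 : (t : ℂ) * Complex.I * (t * Complex.I) = - (t : ℂ) ^ 2 := by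
      linear_combination (t : ℂ) ^ 2 * Complex.I_sq
    simp only [smul_add, smul_neg, smul_smul, h2]
    module
  rw [sq, ← CStarRing.norm_star_mul_self, h]
  refine (norm_add_le _ _).trans ?_
  rw [CStarRing.norm_star_mul_self, norm_smul, ← sq]
  have h1 : ‖(1 : H →L[ℂ] H)‖ ≤ 1 := ContinuousLinearMap.norm_id_le
  have h2 : ‖(t : ℂ) ^ 2‖ = t ^ 2 := by simp
  rw [h2]
  nlinarith [sq_nonneg t]

namespace IsNormalPositiveFunctional

variable {M : VonNeumannAlgebra H} {f g : M.toStarSubalgebra →ₗ[ℂ] ℂ}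

theorem add (hf : M.IsNormalPositiveFunctional f) (hg : M.IsNormalPositiveFunctional g) :
    M.IsNormalPositiveFunctional (f + g) where
  exists_bound := by
    obtain ⟨c, hc, hc'⟩ := hf.exists_bound
    obtain ⟨d, hd, hd'⟩ := hg.exists_bound
    refine ⟨c + d, by simp [hc, hd], fun x => ?_⟩
    have := norm_add_le (f x) (g x)
    simp only [LinearMap.add_apply]
    linarith [hc' x, hd' x]
  continuous := by
    let := M.weakStar
    exact Continuous.add hf.continuous hg.continuous

theorem smul (hf : M.IsNormalPositiveFunctional f) {r : ℝ} (hr : 0 ≤ r) :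
    M.IsNormalPositiveFunctional ((r : ℂ) • f) where
  exists_bound := by
    obtain ⟨c, hc, hc'⟩ := hf.exists_bound
    refine ⟨r * c, by simp [hc], fun x => ?_⟩
    have := mul_le_mul_of_nonneg_left (hc' x) hr
    simp only [LinearMap.smul_apply, norm_smul, Complex.norm_real, Real.norm_of_nonneg hr]
    linarith
  continuous := @Continuous.const_smul _ _ _ _ _ _ M.weakStar _ hf.continuous _

theorem re_one_nonneg (hf : M.IsNormalPositiveFunctional f) : 0 ≤ (f 1).re := by
  obtain ⟨c, hc, hc'⟩ := hf.exists_bound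
  have h := hc' 1
  rw [hc, Complex.ofReal_re]
  by_contra! hneg
  have h1 : 0 ≤ ‖((1 : M.toStarSubalgebra) : H →L[ℂ] H)‖ := norm_nonneg _
  have h2 : ‖f 1‖ = 0 := le_antisymm (by nlinarith) (norm_nonneg _)
  rw [norm_eq_zero, hc] at h2
  have : c = 0 := by exact_mod_cast h2
  linarith

theorem one_eq (hf : M.IsNormalPositiveFunctional f) : f 1 = ((f 1).re : ℂ) := by
  obtain ⟨c, hc, hc'⟩ := hf.exists_bound
  simp [hc]

theorem norm_le (hf : M.IsNormalPositiveFunctional f) (x : M.toStarSubalgebra) :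
    ‖f x‖ ≤ (f 1).re * ‖(x : H →L[ℂ] H)‖ := by
  obtain ⟨c, hc, hc'⟩ := hf.exists_bound
  simpa [hc] using hc' x

theorem eq_zero (hf : M.IsNormalPositiveFunctional f) (h : f 1 = 0) : f = 0 := by
  ext x
  have := hf.norm_le x
  simpa [h] using this

/-- Shifting `x` by `it` adds `tc` to the imaginary part, while the squared norm grows only by `t ^
2`. Hence `b ^ 2 + 2tbc ≤ c ^ 2 * N ^ 2` for all real `t`, where `b` is the imaginary part and `N`
the norm of `x`; this forces `b = 0`. -/
theorem im_eq_zero (hf : M.IsNormalPositiveFunctional f) {x : M.toStarSubalgebra}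
    (hx : IsSelfAdjoint (x : H →L[ℂ] H)) : (f x).im = 0 := by
  set c := (f 1).re with hc
  have hc0 : 0 ≤ c := hf.re_one_nonneg
  have key : ∀ t : ℝ, ((f x).im + t * c) ^ 2 ≤ c ^ 2 * (‖(x : H →L[ℂ] H)‖ ^ 2 + t ^ 2) := by
    intro t
    have h1 := hf.norm_le (x + ((t : ℂ) * Complex.I) • (1 : M.toStarSubalgebra))
    have h2 := norm_add_I_smul_sq_le hx t
    have h3 : (f (x + ((t : ℂ) * Complex.I) • (1 : M.toStarSubalgebra))).im =
        (f x).im + t * c := by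
      rw [map_add, map_smul, hf.one_eq]
      simp [hc]
    rw [← h3]
    have h4 := Complex.abs_im_le_norm (f (x + ((t : ℂ) * Complex.I) • (1 : M.toStarSubalgebra)))
    have h5 := sq_le_sq' (by linarith [abs_nonneg (f (x + ((t : ℂ) * Complex.I) •
      (1 : M.toStarSubalgebra))).im, norm_nonneg (f (x + ((t : ℂ) * Complex.I) •
      (1 : M.toStarSubalgebra)))]) (h4.trans h1)
    rw [sq_abs, mul_pow] at h5
    refine h5.trans (mul_le_mul_of_nonneg_left ?_ (sq_nonneg _))
    simpa using h2
  rcases hc0.eq_or_lt with h0 | hpos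
  · have := key 0
    rw [← h0] at this
    nlinarith [sq_nonneg (f x).im]
  · by_contra hne
    set b := (f x).im
    set N := ‖(x : H →L[ℂ] H)‖
    -- This `t` makes `tbc = c ^ 2 * N ^ 2`, so `key` would give `b ^ 2 + c ^ 2 * N ^ 2 ≤ 0`.
    have := key ((c ^ 2 * N ^ 2) / (b * c))
    have e : (c ^ 2 * N ^ 2) / (b * c) * c * b = c ^ 2 * N ^ 2 := by field_simp
    have hb : 0 < b ^ 2 := by positivity
    have : 0 ≤ c ^ 2 * N ^ 2 := by positivity
    nlinarith

/-- From `0 ≤ x ≤ N` follows `‖N - x‖ ≤ N`, so `N * f 1 - re (f x) ≤ N * f 1`. -/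
theorem apply_nonneg (hf : M.IsNormalPositiveFunctional f) {x : M.toStarSubalgebra}
    (hx : (x : H →L[ℂ] H).IsPositive) : 0 ≤ (f x).re := by
  set N := ‖(x : H →L[ℂ] H)‖
  have hx0 : 0 ≤ (x : H →L[ℂ] H) := (ContinuousLinearMap.nonneg_iff_isPositive _).2 hx
  have hle : (x : H →L[ℂ] H) ≤ algebraMap ℝ (H →L[ℂ] H) N := IsSelfAdjoint.le_algebraMap_norm_self hx.isSelfAdjoint
  have h1 : ‖algebraMap ℝ (H →L[ℂ] H) N - (x : H →L[ℂ] H)‖ ≤ N := by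
    rw [CStarAlgebra.norm_le_iff_le_algebraMap _ (norm_nonneg _) (sub_nonneg.2 hle)]
    exact sub_le_self _ hx0
  have h2 := hf.norm_le ((N : ℂ) • 1 - x)
  have h3 : (((N : ℂ) • 1 - x : M.toStarSubalgebra) : H →L[ℂ] H) =
      algebraMap ℝ (H →L[ℂ] H) N - (x : H →L[ℂ] H) := by
    ext v
    simp [Algebra.algebraMap_eq_smul_one]
  rw [h3] at h2
  have h4 := (Complex.re_le_norm _).trans (h2.trans (mul_le_mul_of_nonneg_left h1 hf.re_one_nonneg))
  rw [map_sub, map_smul, Complex.sub_re] at h4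
  have : ((N : ℂ) • f 1).re = N * (f 1).re := by simp
  rw [this] at h4
  linarith

theorem map_star (hf : M.IsNormalPositiveFunctional f) (x : M.toStarSubalgebra) :
    f (star x) = star (f x) := by
  have h1 := hf.im_eq_zero (x := x + star x) (by simp)
  have h2 := hf.im_eq_zero (x := Complex.I • (x - star x)) (by
    rw [isSelfAdjoint_iff]
    simp only [StarMemClass.coe_star, SetLike.val_smul, AddSubgroupClass.coe_sub, star_smul,
      star_sub, star_star, RCLike.star_def, Complex.conj_I]
    module)
  simp only [map_add, map_smul, map_sub, Complex.add_im, smul_eq_mul, Complex.mul_im,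
    Complex.I_re, Complex.I_im, Complex.sub_re] at h1 h2
  apply Complex.ext
  · simp only [RCLike.star_def, Complex.conj_re]; linarith
  · simp only [RCLike.star_def, Complex.conj_im]; linarith

theorem isNormalState (hf : M.IsNormalPositiveFunctional f) (h : f 1 = 1) : M.IsNormalState f where
  map_one := h
  contractive x := by simpa [h] using hf.norm_le x
  continuous := hf.continuous

end IsNormalPositiveFunctional

theorem IsNormalState.isNormalPositiveFunctional {M : VonNeumannAlgebra H}
    {f : M.toStarSubalgebra →ₗ[ℂ] ℂ} (hf : M.IsNormalState f) : M.IsNormalPositiveFunctional f where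
  exists_bound := ⟨1, by simp [hf.map_one], by simpa only [one_mul] using hf.contractive⟩
  continuous := hf.continuous

open scoped ComplexOrder in
/-- A positive functional satisfies `‖f‖ ≤ f 1`. -/
theorem isNormalPositiveFunctional_of_nonneg {M : VonNeumannAlgebra H}
    {f : M.toStarSubalgebra →ₗ[ℂ] ℂ} (hc : Continuous[M.weakStar, inferInstance] f)
    (hf : ∀ x : M.toStarSubalgebra, (x : H →L[ℂ] H).IsPositive → 0 ≤ f x) :
    M.IsNormalPositiveFunctional f where
  continuous := hc
  exists_bound := by
    have hsa : ∀ x : M.toStarSubalgebra, IsSelfAdjoint (x : H →L[ℂ] H) →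
        f x ≤ (‖(x : H →L[ℂ] H)‖ : ℂ) * f 1 := by
      intro x hx
      have h := hf ((‖(x : H →L[ℂ] H)‖ : ℂ) • 1 - x) (by
        rw [← ContinuousLinearMap.nonneg_iff_isPositive]
        have := sub_nonneg.2 (IsSelfAdjoint.le_algebraMap_norm_self hx)
        convert this using 1
        ext v
        simp [Algebra.algebraMap_eq_smul_one])
      rw [map_sub, map_smul, smul_eq_mul] at h
      exact sub_nonneg.1 h
    have h1 : 0 ≤ f 1 := hf 1 (by simp)
    have him1 : (f 1).im = 0 := (Complex.nonneg_iff.1 h1).2.symm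
    have hre1 : 0 ≤ (f 1).re := (Complex.nonneg_iff.1 h1).1
    refine ⟨(f 1).re, Complex.ext rfl (by simp [him1]), fun x => ?_⟩
    -- Rotating `x` by a phase makes the value of `f` real and equal to `‖f x‖`.
    obtain ⟨u, hu, hux⟩ : ∃ u : ℂ, ‖u‖ = 1 ∧ u * f x = ‖f x‖ := by
      rcases eq_or_ne (f x) 0 with h0 | h0
      · exact ⟨1, by simp, by simp [h0]⟩
      · have hn : (‖f x‖ : ℂ) ≠ 0 := by simpa using h0
        refine ⟨star (f x) / ‖f x‖, by simp [h0], ?_⟩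
        rw [div_mul_eq_mul_div, div_eq_iff hn, RCLike.star_def, mul_comm, Complex.mul_conj,
          Complex.normSq_eq_norm_sq]
        push_cast; ring
    set y : M.toStarSubalgebra := u • x with hy
    have hny : ‖(y : H →L[ℂ] H)‖ = ‖(x : H →L[ℂ] H)‖ := by
      rw [hy, SetLike.val_smul, norm_smul, hu, one_mul]
    have hfy : f y = ‖f x‖ := by rw [hy, map_smul, smul_eq_mul, hux]
    -- The complex order also compares imaginary parts: here it gives `re (f (star y)) = re (f y)`,
    -- so `h3` bounds `2 * ‖f x‖`.
    have h2 := hsa (Complex.I • (y - star y)) (by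
      rw [isSelfAdjoint_iff]
      simp only [StarMemClass.coe_star, SetLike.val_smul, AddSubgroupClass.coe_sub, star_smul,
        star_sub, star_star, RCLike.star_def, Complex.conj_I]
      module)
    have h3 := hsa (y + star y) (by simp)
    have h4 : ‖((y + star y : M.toStarSubalgebra) : H →L[ℂ] H)‖ ≤ 2 * ‖(x : H →L[ℂ] H)‖ := by
      rw [two_mul, ← hny]
      simpa using norm_add_le (y : H →L[ℂ] H) (star (y : H →L[ℂ] H))
    have h5 := (Complex.le_def.1 h2).2
    have h6 := (Complex.le_def.1 h3).1
    simp only [map_add, map_smul, map_sub, hfy, smul_eq_mul, Complex.mul_im, Complex.I_re,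
      Complex.I_im, Complex.sub_re, Complex.ofReal_re, Complex.ofReal_im, him1, Complex.add_re,
      Complex.mul_re] at h5 h6
    nlinarith

/-! ### Sesquilinear forms and vector functionals -/

theorem sesquilinear_polarization {E V : Type*} [AddCommGroup E] [Module ℂ E] [AddCommGroup V]
    [Module ℂ V] (B : E →ₗ⋆[ℂ] E →ₗ[ℂ] V) (η ξ : E) :
    B η ξ = (4⁻¹ : ℂ) • (B (η + ξ) (η + ξ) - B (η - ξ) (η - ξ)
      - Complex.I • B (η + Complex.I • ξ) (η + Complex.I • ξ)
      + Complex.I • B (η - Complex.I • ξ) (η - Complex.I • ξ)) := by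
  have hI : ∀ v, B (Complex.I • v) = (-Complex.I) • B v := fun v => by
    rw [B.map_smulₛₗ, Complex.conj_I]
  simp only [map_add, map_sub, LinearMap.add_apply, LinearMap.sub_apply, map_smul, hI,
    LinearMap.smul_apply, LinearMap.neg_apply, smul_add, smul_sub, smul_smul, neg_smul, smul_neg,
    Complex.I_mul_I,
    neg_neg, one_smul]
  module

/-- Operators from a family of bounded quadratic forms that depends linearly on a parameter. -/
theorem exists_linearMap_of_form {V : Type*} [AddCommGroup V] [Module ℂ V]
    (B : K →ₗ⋆[ℂ] K →ₗ[ℂ] (V →ₗ[ℂ] ℂ))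
    (hB : ∀ x, ∃ C : ℝ, ∀ ξ, ‖B ξ ξ x‖ ≤ C * ‖ξ‖ ^ 2) :
    ∃ Ψ : V →ₗ[ℂ] (K →L[ℂ] K), ∀ x η ξ, inner ℂ η (Ψ x ξ) = B η ξ x := by
  have hbound : ∀ x, ∃ C : ℝ, ∀ η ξ, ‖B η ξ x‖ ≤ C * ‖η‖ * ‖ξ‖ := by
    intro x
    obtain ⟨C, hC⟩ := hB x
    -- Polarization has four diagonal terms with weight `1/4`, each at a vector of norm at most `2`,
    -- hence each at most `4 * |C|`.
    have hunit : ∀ η ξ : K, ‖η‖ = 1 → ‖ξ‖ = 1 → ‖B η ξ x‖ ≤ 4 * |C| := by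
      intro η ξ hη hξ
      have hq : ∀ v : K, ‖v‖ ≤ 2 → ‖B v v x‖ ≤ 4 * |C| := by
        intro v hv
        refine (hC v).trans ?_
        have hv2 : ‖v‖ ^ 2 ≤ 4 := by nlinarith [norm_nonneg v]
        nlinarith [mul_le_mul_of_nonneg_right (le_abs_self C) (sq_nonneg ‖v‖),
          mul_le_mul_of_nonneg_left hv2 (abs_nonneg C)]
      have hIξ : ‖Complex.I • ξ‖ = 1 := by simp [norm_smul, hξ]
      have h1 := hq (η + ξ) ((norm_add_le _ _).trans (by linarith))
      have h2 := hq (η - ξ) ((norm_sub_le _ _).trans (by linarith))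
      have h3 := hq (η + Complex.I • ξ) ((norm_add_le _ _).trans (by linarith))
      have h4 := hq (η - Complex.I • ξ) ((norm_sub_le _ _).trans (by linarith))
      rw [sesquilinear_polarization B η ξ]
      simp only [LinearMap.smul_apply, LinearMap.add_apply, LinearMap.sub_apply, norm_smul]
      have h5 := norm_add_le (B (η + ξ) (η + ξ) x - B (η - ξ) (η - ξ) x
        - Complex.I • B (η + Complex.I • ξ) (η + Complex.I • ξ) x)
        (Complex.I • B (η - Complex.I • ξ) (η - Complex.I • ξ) x)
      have h6 := norm_sub_le (B (η + ξ) (η + ξ) x - B (η - ξ) (η - ξ) x)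
        (Complex.I • B (η + Complex.I • ξ) (η + Complex.I • ξ) x)
      have h7 := norm_sub_le (B (η + ξ) (η + ξ) x) (B (η - ξ) (η - ξ) x)
      rw [norm_smul, Complex.norm_I, one_mul] at h5 h6
      have h8 : ‖(4⁻¹ : ℂ)‖ = 4⁻¹ := by simp
      rw [h8]
      linarith
    refine ⟨4 * |C|, fun η ξ => ?_⟩
    rcases eq_or_ne η 0 with rfl | hη
    · simp
    rcases eq_or_ne ξ 0 with rfl | hξ
    · simp
    have hη' : (‖η‖ : ℝ) ≠ 0 := norm_ne_zero_iff.2 hη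
    have hξ' : (‖ξ‖ : ℝ) ≠ 0 := norm_ne_zero_iff.2 hξ
    have h := hunit ((‖η‖⁻¹ : ℂ) • η) ((‖ξ‖⁻¹ : ℂ) • ξ) (by simp [norm_smul, hη])
      (by simp [norm_smul, hξ])
    simp only [LinearMap.map_smulₛₗ, LinearMap.smul_apply, norm_smul, map_inv₀,
      Complex.conj_ofReal, norm_inv, Complex.norm_real, norm_norm, RingHom.id_apply] at h
    have e : ‖B η ξ x‖ = ‖ξ‖⁻¹ * (‖η‖⁻¹ * ‖B η ξ x‖) * (‖η‖ * ‖ξ‖) := by field_simp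
    rw [e]
    rw [mul_assoc (4 * |C|)]
    refine mul_le_mul_of_nonneg_right ?_ (by positivity)
    linarith
  have hop : ∀ x, ∃ T : K →L[ℂ] K, ∀ η ξ, inner ℂ η (T ξ) = B η ξ x := by
    intro x
    obtain ⟨C, hC⟩ := hbound x
    let b : K →L⋆[ℂ] K →L[ℂ] ℂ := LinearMap.mkContinuous₂
      (LinearMap.mk₂'ₛₗ (starRingEnd ℂ) (RingHom.id ℂ) (fun η ξ => B η ξ x)
        (by simp) (by simp) (by simp) (by simp)) C hC
    -- `continuousLinearMapOfBilin` puts the operator in the first slot of the inner product; the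
    -- adjoint moves it to the second.
    refine ⟨ContinuousLinearMap.adjoint (InnerProductSpace.continuousLinearMapOfBilin b),
      fun η ξ => ?_⟩
    rw [ContinuousLinearMap.adjoint_inner_right,
      InnerProductSpace.continuousLinearMapOfBilin_apply]
    rfl
  choose T hT using hop
  refine ⟨{ toFun := T, map_add' := fun x y => ?_, map_smul' := fun c x => ?_ }, hT⟩
  · ext ξ
    refine ext_inner_left ℂ fun η => ?_
    rw [add_apply, inner_add_right, hT, hT, hT, map_add]
  · ext ξ
    refine ext_inner_left ℂ fun η => ?_
    rw [RingHom.id_apply, smul_apply, inner_smul_right, hT, hT, map_smul,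
      smul_eq_mul]

/-- The functionals `x ↦ ⟨η, x ξ⟩` on `M`. -/
noncomputable def vectorFunctional (M : VonNeumannAlgebra H) :
    H →ₗ⋆[ℂ] H →ₗ[ℂ] (M.toStarSubalgebra →ₗ[ℂ] ℂ) :=
  LinearMap.mk₂'ₛₗ (starRingEnd ℂ) (RingHom.id ℂ)
    (fun η ξ =>
      { toFun := fun x => inner ℂ η ((x : H →L[ℂ] H) ξ)
        map_add' := by simp
        map_smul' := by simp })
    (by intros; ext; simp) (by intros; ext; simp [mul_comm])
    (by intros; ext; simp) (by intros; ext; simp)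

@[simp]
theorem vectorFunctional_apply (M : VonNeumannAlgebra H) (η ξ : H) (x : M.toStarSubalgebra) :
    M.vectorFunctional η ξ x = inner ℂ η ((x : H →L[ℂ] H) ξ) := rfl

omit [CompleteSpace H] in
theorem summable_norm_inner_apply {ξ η : ℕ → H} (hξ : Summable fun n => ‖ξ n‖ ^ 2)
    (hη : Summable fun n => ‖η n‖ ^ 2) (T : H →L[ℂ] H) :
    Summable fun n => ‖inner ℂ (η n) (T (ξ n))‖ := by
  refine Summable.of_nonneg_of_le (fun _ => norm_nonneg _) (fun n => ?_)
    ((hξ.add hη).mul_left ‖T‖)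
  have h1 := norm_inner_le_norm (𝕜 := ℂ) (η n) (T (ξ n))
  have h2 := mul_le_mul_of_nonneg_left (T.le_opNorm (ξ n)) (norm_nonneg (η n))
  have h3 : ‖η n‖ * ‖ξ n‖ ≤ ‖ξ n‖ ^ 2 + ‖η n‖ ^ 2 := by
    nlinarith [sq_nonneg (‖η n‖ - ‖ξ n‖), sq_nonneg ‖η n‖, sq_nonneg ‖ξ n‖]
  nlinarith [mul_le_mul_of_nonneg_left h3 (norm_nonneg T)]

/-- The functional `x ↦ ∑ₙ ⟨ξₙ, x ξₙ⟩` on `M`. -/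
noncomputable def sumFunctional (M : VonNeumannAlgebra H) (ξ : ℕ → H)
    (hξ : Summable fun n => ‖ξ n‖ ^ 2) : M.toStarSubalgebra →ₗ[ℂ] ℂ where
  toFun x := ∑' n, inner ℂ (ξ n) ((x : H →L[ℂ] H) (ξ n))
  map_add' x y := by
    rw [← Summable.tsum_add (summable_norm_inner_apply hξ hξ _).of_norm
      (summable_norm_inner_apply hξ hξ _).of_norm]
    simp
  map_smul' c x := by
    rw [RingHom.id_apply, smul_eq_mul, ← tsum_mul_left]
    simp

theorem sumFunctional_apply (M : VonNeumannAlgebra H) (ξ : ℕ → H)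
    (hξ : Summable fun n => ‖ξ n‖ ^ 2) (x : M.toStarSubalgebra) :
    M.sumFunctional ξ hξ x = ∑' n, inner ℂ (ξ n) ((x : H →L[ℂ] H) (ξ n)) := rfl

theorem sumFunctional_one (M : VonNeumannAlgebra H) (ξ : ℕ → H)
    (hξ : Summable fun n => ‖ξ n‖ ^ 2) : M.sumFunctional ξ hξ 1 = ((∑' n, ‖ξ n‖ ^ 2 : ℝ) : ℂ) := by
  rw [sumFunctional_apply, Complex.ofReal_tsum]
  refine tsum_congr fun n => ?_
  simp [inner_self_eq_norm_sq_to_K]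

theorem continuous_tsum_inner (M : VonNeumannAlgebra H) {ξ η : ℕ → H}
    (hξ : Summable fun n => ‖ξ n‖ ^ 2) (hη : Summable fun n => ‖η n‖ ^ 2) :
    Continuous[M.weakStar, inferInstance]
      (fun x : M.toStarSubalgebra => ∑' n, inner ℂ (η n) ((x : H →L[ℂ] H) (ξ n))) := by
  have h : Continuous[ultraweakTopology H, inferInstance]
      (fun x : H →L[ℂ] H => ∑' n, inner ℂ (η n) (x (ξ n))) :=
    continuous_iInf_dom (i := ⟨(ξ, η), hξ, hη⟩) continuous_induced_dom
  exact @Continuous.comp _ _ _ M.weakStar (ultraweakTopology H) _ _ _ h continuous_induced_dom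

theorem isNormalPositiveFunctional_sumFunctional (M : VonNeumannAlgebra H) (ξ : ℕ → H)
    (hξ : Summable fun n => ‖ξ n‖ ^ 2) :
    M.IsNormalPositiveFunctional (M.sumFunctional ξ hξ) where
  exists_bound := by
    refine ⟨_, M.sumFunctional_one ξ hξ, fun x => ?_⟩
    rw [sumFunctional_apply, ← tsum_mul_right]
    refine (norm_tsum_le_tsum_norm (summable_norm_inner_apply hξ hξ _)).trans ?_
    refine (summable_norm_inner_apply hξ hξ _).tsum_le_tsum (fun n => ?_) (hξ.mul_right _)
    have h1 := norm_inner_le_norm (𝕜 := ℂ) (ξ n) ((x : H →L[ℂ] H) (ξ n))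
    have h2 := mul_le_mul_of_nonneg_left ((x : H →L[ℂ] H).le_opNorm (ξ n)) (norm_nonneg (ξ n))
    linarith
  continuous := M.continuous_tsum_inner hξ hξ

theorem isNormalPositiveFunctional_vectorFunctional (M : VonNeumannAlgebra H) (ξ : H) :
    M.IsNormalPositiveFunctional (M.vectorFunctional ξ ξ) := by
  have hs : Summable fun n : ℕ => ‖(Pi.single 0 ξ : ℕ → H) n‖ ^ 2 :=
    summable_of_ne_finset_zero (s := {0}) fun n hn => by
      rw [Finset.mem_singleton] at hn; simp [hn]
  convert M.isNormalPositiveFunctional_sumFunctional (Pi.single 0 ξ) hs using 1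
  ext x
  rw [sumFunctional_apply, tsum_eq_single 0 fun n hn => by simp [hn]]
  simp

theorem sumFunctional_eq_add (M : VonNeumannAlgebra H) (ξ : ℕ → H)
    (hξ : Summable fun n => ‖ξ n‖ ^ 2) (hξ' : Summable fun n => ‖ξ (n + 1)‖ ^ 2) :
    M.sumFunctional ξ hξ = M.vectorFunctional (ξ 0) (ξ 0) +
      M.sumFunctional (fun n => ξ (n + 1)) hξ' := by
  ext x
  rw [sumFunctional_apply, (summable_norm_inner_apply hξ hξ _).of_norm.tsum_eq_zero_add]
  rfl

/-! ### Unique extension of positive functionals and its linear span -/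

section Extension

variable {M : VonNeumannAlgebra H} {D : VonNeumannAlgebra K}
  {A : Subalgebra ℂ M.toStarSubalgebra} {Φ : A →ₗ[ℂ] D.toStarSubalgebra}

/-- `g` is a normal positive extension to `M` of the pullback along `Φ` of the normal positive
functional `f`. -/
structure IsPositiveExtension (Φ : A →ₗ[ℂ] D.toStarSubalgebra)
    (f : D.toStarSubalgebra →ₗ[ℂ] ℂ) (g : M.toStarSubalgebra →ₗ[ℂ] ℂ) : Prop where
  left : D.IsNormalPositiveFunctional f
  right : M.IsNormalPositiveFunctional g
  apply_eq : ∀ a : A, g (a : M.toStarSubalgebra) = f (Φ a)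

/-- Every normal state of `D`, pulled back along `Φ`, has exactly one normal state extension. -/
def HasUniqueStateExtension (Φ : A →ₗ[ℂ] D.toStarSubalgebra) : Prop :=
  ∀ φ : D.toStarSubalgebra →ₗ[ℂ] ℂ, D.IsNormalState φ →
    ∃! ψ : M.toStarSubalgebra →ₗ[ℂ] ℂ,
      M.IsNormalState ψ ∧ ∀ a : A, ψ (a : M.toStarSubalgebra) = φ (Φ a)

variable {f f' : D.toStarSubalgebra →ₗ[ℂ] ℂ} {g g' : M.toStarSubalgebra →ₗ[ℂ] ℂ}

namespace IsPositiveExtension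

theorem add (h : IsPositiveExtension Φ f g) (h' : IsPositiveExtension Φ f' g') :
    IsPositiveExtension Φ (f + f') (g + g') :=
  ⟨h.left.add h'.left, h.right.add h'.right, fun a => by simp [h.apply_eq, h'.apply_eq]⟩

theorem smul (h : IsPositiveExtension Φ f g) {r : ℝ} (hr : 0 ≤ r) :
    IsPositiveExtension Φ ((r : ℂ) • f) ((r : ℂ) • g) :=
  ⟨h.left.smul hr, h.right.smul hr, fun a => by simp [h.apply_eq]⟩

theorem apply_one (h : IsPositiveExtension Φ f g) (hΦ : Φ 1 = 1) : g 1 = f 1 := by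
  simpa [hΦ] using h.apply_eq 1

theorem norm_le (h : IsPositiveExtension Φ f g) (hΦ : Φ 1 = 1) (x : M.toStarSubalgebra) :
    ‖g x‖ ≤ (f 1).re * ‖(x : H →L[ℂ] H)‖ := by
  simpa [h.apply_one hΦ] using h.right.norm_le x

end IsPositiveExtension

theorem IsNormalPositiveFunctional.zero (M : VonNeumannAlgebra H) :
    M.IsNormalPositiveFunctional 0 where
  exists_bound := ⟨0, by simp⟩
  continuous := @continuous_const _ _ M.weakStar _ _

theorem IsNormalPositiveFunctional.exists_extension (hf : D.IsNormalPositiveFunctional f)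
    (hΦ : HasUniqueStateExtension Φ) : ∃ g, IsPositiveExtension Φ f g := by
  rcases eq_or_ne (f 1) 0 with h0 | h0
  · rw [hf.eq_zero h0]
    exact ⟨0, .zero D, .zero M, by simp⟩
  · have h1 := hf.one_eq
    have hr := hf.re_one_nonneg
    have hr0 : (((f 1).re : ℝ) : ℂ) ≠ 0 := by rwa [← h1]
    have hn : D.IsNormalPositiveFunctional ((((f 1).re⁻¹ : ℝ) : ℂ) • f) :=
      hf.smul (inv_nonneg.2 hr)
    obtain ⟨ψ, ⟨hψ, hψ'⟩, -⟩ := hΦ _ (hn.isNormalState (by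
      rw [LinearMap.smul_apply, smul_eq_mul, h1, Complex.ofReal_re, Complex.ofReal_inv,
        inv_mul_cancel₀ hr0]))
    refine ⟨((f 1).re : ℂ) • ψ, hf, hψ.isNormalPositiveFunctional.smul hr, fun a => ?_⟩
    rw [LinearMap.smul_apply, hψ', LinearMap.smul_apply, smul_smul, Complex.ofReal_inv,
      mul_inv_cancel₀ hr0, one_smul]

namespace IsPositiveExtension

theorem unique (hΦ1 : Φ 1 = 1) (hΦ : HasUniqueStateExtension Φ)
    (h : IsPositiveExtension Φ f g) (h' : IsPositiveExtension Φ f g') : g = g' := by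
  rcases eq_or_ne (f 1) 0 with h0 | h0
  · rw [h.right.eq_zero ((h.apply_one hΦ1).trans h0),
      h'.right.eq_zero ((h'.apply_one hΦ1).trans h0)]
  · have h1 := h.left.one_eq
    have hr := inv_nonneg.2 h.left.re_one_nonneg
    have hr0 : (((f 1).re : ℝ) : ℂ) ≠ 0 := by rwa [← h1]
    have hone : (((f 1).re⁻¹ : ℝ) : ℂ) • f 1 = 1 := by
      rw [smul_eq_mul, h1, Complex.ofReal_re, Complex.ofReal_inv, inv_mul_cancel₀ hr0]
    have hs := h.smul hr
    have hs' := h'.smul hr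
    obtain ⟨ψ, -, hu⟩ := hΦ _ (hs.left.isNormalState hone)
    have e := hu _ ⟨hs.right.isNormalState ((hs.apply_one hΦ1).trans hone), hs.apply_eq⟩
    have e' := hu _ ⟨hs'.right.isNormalState ((hs'.apply_one hΦ1).trans hone), hs'.apply_eq⟩
    exact smul_right_injective _ (by simpa using hr0) (e.trans e'.symm)

end IsPositiveExtension

/-- The graph of the linear map from functionals on `D` to functionals on `M` which is spanned by
the normal positive extensions. -/
noncomputable def extensionGraph (Φ : A →ₗ[ℂ] D.toStarSubalgebra) :
    Submodule ℂ ((D.toStarSubalgebra →ₗ[ℂ] ℂ) × (M.toStarSubalgebra →ₗ[ℂ] ℂ)) :=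
  Submodule.span ℂ {p | IsPositiveExtension Φ p.1 p.2}

theorem IsPositiveExtension.mem_extensionGraph (h : IsPositiveExtension Φ f g) :
    (f, g) ∈ extensionGraph Φ :=
  Submodule.subset_span h

theorem apply_eq_of_mem_extensionGraph (h : (f, g) ∈ extensionGraph Φ) (a : A) :
    g (a : M.toStarSubalgebra) = f (Φ a) := by
  have : ∀ p ∈ extensionGraph Φ, p.2 (a : M.toStarSubalgebra) = p.1 (Φ a) := by
    intro p hp
    induction hp using Submodule.span_induction with
    | mem p hp => exact hp.apply_eq a
    | zero => simp
    | add p q _ _ hp hq => simp [hp, hq]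
    | smul c p _ hp => simp [hp]
  exact this _ h

/-- A complex linear combination of extensions is a combination of four of them. -/
theorem exists_of_mem_extensionGraph
    {p : (D.toStarSubalgebra →ₗ[ℂ] ℂ) × (M.toStarSubalgebra →ₗ[ℂ] ℂ)}
    (hp : p ∈ extensionGraph Φ) :
    ∃ a b c d : (D.toStarSubalgebra →ₗ[ℂ] ℂ) × (M.toStarSubalgebra →ₗ[ℂ] ℂ),
      IsPositiveExtension Φ a.1 a.2 ∧ IsPositiveExtension Φ b.1 b.2 ∧
      IsPositiveExtension Φ c.1 c.2 ∧ IsPositiveExtension Φ d.1 d.2 ∧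
      p = a - b + Complex.I • (c - d) := by
  have h0 : IsPositiveExtension Φ 0 0 := ⟨.zero D, .zero M, by simp⟩
  induction hp using Submodule.span_induction with
  | mem p hp => exact ⟨p, 0, 0, 0, hp, h0, h0, h0, by simp⟩
  | zero => exact ⟨0, 0, 0, 0, h0, h0, h0, h0, by simp⟩
  | add p q _ _ hp hq =>
    obtain ⟨a, b, c, d, ha, hb, hc, hd, rfl⟩ := hp
    obtain ⟨a', b', c', d', ha', hb', hc', hd', rfl⟩ := hq
    exact ⟨a + a', b + b', c + c', d + d', ha.add ha', hb.add hb', hc.add hc', hd.add hd',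
      by module⟩
  | smul z p _ hp =>
    obtain ⟨a, b, c, d, ha, hb, hc, hd, rfl⟩ := hp
    have hr := posPart_nonneg z.re
    have hr' := negPart_nonneg z.re
    have hi := posPart_nonneg z.im
    have hi' := negPart_nonneg z.im
    let r : ℂ := (z.re⁺ : ℝ)
    let s : ℂ := (z.re⁻ : ℝ)
    let t : ℂ := (z.im⁺ : ℝ)
    let u : ℂ := (z.im⁻ : ℝ)
    -- The coefficients must stay nonnegative, so each sign is absorbed by swapping `a` with `b` or
    -- `c` with `d`; multiplication by `I` turns `(a - b) + I (c - d)` into `(d - c) + I (a - b)`.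
    refine ⟨r • a + s • b + t • d + u • c, r • b + s • a + t • c + u • d,
      r • c + s • d + t • a + u • b, r • d + s • c + t • b + u • a,
      (((ha.smul hr).add (hb.smul hr')).add (hd.smul hi)).add (hc.smul hi'),
      (((hb.smul hr).add (ha.smul hr')).add (hc.smul hi)).add (hd.smul hi'),
      (((hc.smul hr).add (hd.smul hr')).add (ha.smul hi)).add (hb.smul hi'),
      (((hd.smul hr).add (hc.smul hr')).add (hb.smul hi)).add (ha.smul hi'), ?_⟩
    have hz : z = (r - s) + (t - u) * Complex.I := by
      simp only [r, s, t, u, ← Complex.ofReal_sub, posPart_sub_negPart, Complex.re_add_im]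
    clear_value r s t u
    have hII : ∀ v : (D.toStarSubalgebra →ₗ[ℂ] ℂ) × (M.toStarSubalgebra →ₗ[ℂ] ℂ),
        Complex.I • Complex.I • v = -v := fun v => by
      rw [smul_smul, Complex.I_mul_I, neg_one_smul]
    have key : (r - s + (t - u) * Complex.I) • (a - b + Complex.I • (c - d)) =
        (r - s) • (a - b) + (t - u) • Complex.I • (a - b) + (r - s) • Complex.I • (c - d) +
        (t - u) • Complex.I • Complex.I • (c - d) := by module
    rw [hz, key, hII]
    module

/-- If `a - b + I (c - d) = 0` with all four positive, the hermitian and skew parts vanish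
separately. Then `a = b` and `c = d`, and unique extension cancels the second components too. -/
theorem eq_zero_of_mem_extensionGraph (hΦ1 : Φ 1 = 1) (hΦ : HasUniqueStateExtension Φ)
    (h : (0, g) ∈ extensionGraph Φ) : g = 0 := by
  obtain ⟨⟨a, a'⟩, ⟨b, b'⟩, ⟨c, c'⟩, ⟨d, d'⟩, ha, hb, hc, hd, e⟩ := exists_of_mem_extensionGraph h
  simp only [Prod.mk_sub_mk, Prod.smul_mk, Prod.mk_add_mk, Prod.mk.injEq] at e ha hb hc hd
  obtain ⟨e1, e2⟩ := e
  have hx : ∀ x, a x - b x + Complex.I * (c x - d x) = 0 := fun x => by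
    simpa using (LinearMap.congr_fun e1 x).symm
  have hx' : ∀ x, a x - b x - Complex.I * (c x - d x) = 0 := fun x => by
    have := congrArg star (hx (star x))
    simp only [ha.left.map_star, hb.left.map_star, hc.left.map_star, hd.left.map_star, star_add,
      star_sub, star_mul, star_star, star_zero] at this
    simp only [RCLike.star_def, Complex.conj_I] at this
    linear_combination this
  have hab : a = b := by
    ext x
    linear_combination (hx x + hx' x) / 2
  have hcd : c = d := by
    ext x
    refine sub_eq_zero.1 (mul_left_cancel₀ Complex.I_ne_zero ?_)
    linear_combination (hx x - hx' x) / 2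
  subst hab hcd
  rw [e2, ha.unique hΦ1 hΦ hb, hc.unique hΦ1 hΦ hd]
  simp

theorem unique_of_mem_extensionGraph (hΦ1 : Φ 1 = 1) (hΦ : HasUniqueStateExtension Φ)
    (h : (f, g) ∈ extensionGraph Φ) (h' : (f, g') ∈ extensionGraph Φ) : g = g' := by
  refine sub_eq_zero.1 (eq_zero_of_mem_extensionGraph hΦ1 hΦ ?_)
  simpa using (extensionGraph Φ).sub_mem h h'

theorem exists_mem_extensionGraph_vectorFunctional (hΦ : HasUniqueStateExtension Φ) (η ξ : K) :
    ∃ g, (D.vectorFunctional η ξ, g) ∈ extensionGraph Φ := by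
  choose e he using fun ζ : K =>
    (D.isNormalPositiveFunctional_vectorFunctional ζ).exists_extension hΦ
  refine ⟨(4⁻¹ : ℂ) • (e (η + ξ) - e (η - ξ) - Complex.I • e (η + Complex.I • ξ)
      + Complex.I • e (η - Complex.I • ξ)), ?_⟩
  rw [sesquilinear_polarization]
  have hm := fun ζ => (he ζ).mem_extensionGraph
  exact Submodule.smul_mem _ _ (add_mem (sub_mem (sub_mem (hm _) (hm _))
    (Submodule.smul_mem _ _ (hm _))) (Submodule.smul_mem _ _ (hm _)))

/-- Any choice of extensions is automatically sesquilinear, because the graph is a single-valued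
subspace. -/
theorem exists_form (hΦ1 : Φ 1 = 1) (hΦ : HasUniqueStateExtension Φ) :
    ∃ B : K →ₗ⋆[ℂ] K →ₗ[ℂ] (M.toStarSubalgebra →ₗ[ℂ] ℂ),
      ∀ η ξ, (D.vectorFunctional η ξ, B η ξ) ∈ extensionGraph Φ := by
  choose e he using exists_mem_extensionGraph_vectorFunctional hΦ
  have hu := fun f g g' => @unique_of_mem_extensionGraph _ _ _ _ _ _ _ _ M D A Φ f g g' hΦ1 hΦ
  refine ⟨LinearMap.mk₂'ₛₗ (starRingEnd ℂ) (RingHom.id ℂ) e (fun η η' ξ => ?_) (fun c η ξ => ?_)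
    (fun η ξ ξ' => ?_) (fun c η ξ => ?_), he⟩
  · refine hu _ _ _ (he _ _) ?_
    rw [map_add]
    exact add_mem (he _ _) (he _ _)
  · refine hu _ _ _ (he _ _) ?_
    rw [LinearMap.map_smulₛₗ]
    exact Submodule.smul_mem _ _ (he _ _)
  · refine hu _ _ _ (he _ _) ?_
    rw [map_add]
    exact add_mem (he _ _) (he _ _)
  · refine hu _ _ _ (he _ _) ?_
    rw [LinearMap.map_smulₛₗ]
    exact Submodule.smul_mem _ _ (he _ _)

theorem isPositiveExtension_form (hΦ1 : Φ 1 = 1) (hΦ : HasUniqueStateExtension Φ) {ξ : K}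
    (h : (D.vectorFunctional ξ ξ, g) ∈ extensionGraph Φ) :
    IsPositiveExtension Φ (D.vectorFunctional ξ ξ) g := by
  obtain ⟨g', hg'⟩ := (D.isNormalPositiveFunctional_vectorFunctional ξ).exists_extension hΦ
  rwa [unique_of_mem_extensionGraph hΦ1 hΦ h hg'.mem_extensionGraph]

/-! ### The dual map, its normality and its positivity -/

/-- The dual map of the linear extension map, with values in `D` since `D` is its own bicommutant. -/
theorem exists_dual_map (hΦ1 : Φ 1 = 1) (hΦ : HasUniqueStateExtension Φ) :
    ∃ Ψ : M.toStarSubalgebra →ₗ[ℂ] D.toStarSubalgebra,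
      ∀ η ξ, (D.vectorFunctional η ξ, D.vectorFunctional η ξ ∘ₗ Ψ) ∈ extensionGraph Φ := by
  obtain ⟨B, hB⟩ := exists_form hΦ1 hΦ
  obtain ⟨T, hT⟩ := exists_linearMap_of_form B fun x => ⟨‖(x : H →L[ℂ] H)‖, fun ξ => by
    have h := (isPositiveExtension_form hΦ1 hΦ (hB ξ ξ)).norm_le hΦ1 x
    have h1 : (D.vectorFunctional ξ ξ 1).re = ‖ξ‖ ^ 2 := by
      have := inner_self_eq_norm_sq_to_K (𝕜 := ℂ) ξ
      simp only [vectorFunctional_apply, OneMemClass.coe_one, one_apply_eq_self, this]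
      norm_cast
    rwa [h1, mul_comm] at h⟩
  have hmem : ∀ x, T x ∈ D.toStarSubalgebra := by
    intro x
    change T x ∈ D
    rw [← D.commutant_commutant, mem_commutant_iff]
    intro u hu
    ext ξ
    refine ext_inner_left ℂ fun η => ?_
    change inner ℂ η (u (T x ξ)) = inner ℂ η (T x (u ξ))
    rw [← ContinuousLinearMap.adjoint_inner_left, hT, hT]
    -- For `u` in the commutant these two functionals agree on `D`, so their extensions to `M`
    -- agree, which says that `T x` commutes with `u`.
    have e : D.vectorFunctional (ContinuousLinearMap.adjoint u η) ξ =
        D.vectorFunctional η (u ξ) := by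
      ext d
      have hc : (d : K →L[ℂ] K) * u = u * d := mem_commutant_iff.1 hu d d.2
      rw [vectorFunctional_apply, vectorFunctional_apply, ContinuousLinearMap.adjoint_inner_left]
      exact congrArg (inner ℂ η) (DFunLike.congr_fun hc ξ).symm
    have h1 := hB (ContinuousLinearMap.adjoint u η) ξ
    rw [e] at h1
    rw [unique_of_mem_extensionGraph hΦ1 hΦ h1 (hB η (u ξ))]
  refine ⟨{ toFun := fun x => ⟨T x, hmem x⟩
            map_add' := fun x y => Subtype.ext (map_add T x y)
            map_smul' := fun c x => Subtype.ext (map_smul T c x) }, fun η ξ => ?_⟩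
  convert hB η ξ using 2
  ext x
  exact hT x η ξ

variable {Ψ : M.toStarSubalgebra →ₗ[ℂ] D.toStarSubalgebra}

/-- Splitting off one vector functional at a time: by uniqueness, what remains of `g` is the
positive extension of the tail. -/
theorem exists_sumFunctional_remainder (hΦ1 : Φ 1 = 1) (hΦ : HasUniqueStateExtension Φ)
    (hΨ : ∀ ξ, IsPositiveExtension Φ (D.vectorFunctional ξ ξ) (D.vectorFunctional ξ ξ ∘ₗ Ψ))
    {ξ : ℕ → K} (hξ : Summable fun n => ‖ξ n‖ ^ 2) {g : M.toStarSubalgebra →ₗ[ℂ] ℂ}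
    (hg : IsPositiveExtension Φ (D.sumFunctional ξ hξ) g) (N : ℕ) :
    ∃ r, IsPositiveExtension Φ
        (D.sumFunctional (fun n => ξ (n + N)) ((summable_nat_add_iff N).2 hξ)) r ∧
      ∀ x, g x = (∑ n ∈ Finset.range N, D.vectorFunctional (ξ n) (ξ n) (Ψ x)) + r x := by
  induction N with
  | zero => exact ⟨g, hg, by simp⟩
  | succ N ih =>
    obtain ⟨r, hr, hgr⟩ := ih
    have hN : Summable fun n => ‖ξ (n + N)‖ ^ 2 := (summable_nat_add_iff N).2 hξ
    have hs : Summable fun n => ‖ξ (n + 1 + N)‖ ^ 2 :=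
      (summable_nat_add_iff (f := fun n => ‖ξ (n + N)‖ ^ 2) 1).2 hN
    obtain ⟨r', hr'⟩ := (D.isNormalPositiveFunctional_sumFunctional _ hs).exists_extension hΦ
    have e := D.sumFunctional_eq_add (fun n => ξ (n + N)) hN hs
    have h := (hΨ (ξ (0 + N))).add hr'
    have e2 : r = D.vectorFunctional (ξ (0 + N)) (ξ (0 + N)) ∘ₗ Ψ + r' := by
      refine hr.unique hΦ1 hΦ ?_
      rw [e]
      exact h
    rw [congrArg ξ (Nat.zero_add N)] at e2
    refine ⟨r', ?_, ?_⟩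
    · have e : (fun n => ξ (n + (N + 1))) = fun n => ξ (n + 1 + N) := by
        ext n
        congr 1
        omega
      simpa only [e] using hr'
    · intro x
      have e3 : r x = D.vectorFunctional (ξ N) (ξ N) (Ψ x) + r' x := LinearMap.congr_fun e2 x
      have e4 := Finset.sum_range_succ (fun n => D.vectorFunctional (ξ n) (ξ n) (Ψ x)) N
      exact (hgr x).trans (by linear_combination e3 - e4)

/-- The remainder is positive, so its norm is governed by its value at `1`, the tail of `∑ ‖ξ n‖ ^
2`, which tends to `0`. -/
theorem hasSum_of_sumFunctional_extension (hΦ1 : Φ 1 = 1) (hΦ : HasUniqueStateExtension Φ)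
    (hΨ : ∀ ξ, IsPositiveExtension Φ (D.vectorFunctional ξ ξ) (D.vectorFunctional ξ ξ ∘ₗ Ψ))
    {ξ : ℕ → K} (hξ : Summable fun n => ‖ξ n‖ ^ 2) {g : M.toStarSubalgebra →ₗ[ℂ] ℂ}
    (hg : IsPositiveExtension Φ (D.sumFunctional ξ hξ) g) (x : M.toStarSubalgebra) :
    D.sumFunctional ξ hξ (Ψ x) = g x := by
  have h1 := (summable_norm_inner_apply hξ hξ (Ψ x : K →L[ℂ] K)).of_norm.hasSum.tendsto_sum_nat
  refine tendsto_nhds_unique h1 ?_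
  rw [tendsto_iff_norm_sub_tendsto_zero]
  have h2 := (tendsto_sum_nat_add fun n => ‖ξ n‖ ^ 2).mul_const ‖(x : H →L[ℂ] H)‖
  rw [zero_mul] at h2
  refine squeeze_zero (fun _ => norm_nonneg _) (fun N => ?_) h2
  obtain ⟨r, hr, hgr⟩ := exists_sumFunctional_remainder hΦ1 hΦ hΨ hξ hg N
  have h3 := hr.norm_le hΦ1 x
  rw [sumFunctional_one, Complex.ofReal_re] at h3
  rw [hgr, norm_sub_rev]
  simpa only [vectorFunctional_apply, add_sub_cancel_left] using h3

theorem continuous_of_extension (hΦ1 : Φ 1 = 1) (hΦ : HasUniqueStateExtension Φ)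
    (hΨ : ∀ ξ, IsPositiveExtension Φ (D.vectorFunctional ξ ξ) (D.vectorFunctional ξ ξ ∘ₗ Ψ)) :
    Continuous[M.weakStar, D.weakStar] Ψ := by
  have hdiag : ∀ (ζ : ℕ → K) (hζ : Summable fun n => ‖ζ n‖ ^ 2),
      Continuous[M.weakStar, inferInstance] fun x => D.sumFunctional ζ hζ (Ψ x) := by
    intro ζ hζ
    obtain ⟨g, hg⟩ := (D.isNormalPositiveFunctional_sumFunctional ζ hζ).exists_extension hΦ
    convert hg.right.continuous using 1
    ext x
    exact hasSum_of_sumFunctional_extension hΦ1 hΦ hΨ hζ hg x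
  let := M.weakStar
  rw [continuous_induced_rng, continuous_iInf_rng]
  rintro ⟨⟨ξ, η⟩, hξ, hη⟩
  rw [continuous_induced_rng]
  have hadd : ∀ {a b : ℕ → K}, Summable (fun n => ‖a n‖ ^ 2) → Summable (fun n => ‖b n‖ ^ 2) →
      Summable fun n => ‖a n + b n‖ ^ 2 := by
    intro a b ha hb
    refine Summable.of_nonneg_of_le (fun _ => sq_nonneg _) (fun n => ?_)
      ((ha.add hb).mul_left 2)
    nlinarith [norm_add_le (a n) (b n), norm_nonneg (a n + b n), sq_nonneg (‖a n‖ - ‖b n‖)]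
  have hneg : ∀ {a : ℕ → K}, Summable (fun n => ‖a n‖ ^ 2) → Summable fun n => ‖-a n‖ ^ 2 := by
    intro a ha
    simpa using ha
  have hI : Summable fun n => ‖Complex.I • ξ n‖ ^ 2 := by simpa [norm_smul] using hξ
  have h1 := hadd hη hξ
  have h2 := hadd hη (hneg hξ)
  have h3 := hadd hη hI
  have h4 := hadd hη (hneg hI)
  -- Termwise polarization reduces the defining functionals of the ultraweak topology to the
  -- diagonal ones treated in `hdiag`.
  have key : ∀ d : D.toStarSubalgebra, ∑' n, inner ℂ (η n) ((d : K →L[ℂ] K) (ξ n)) =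
      (4⁻¹ : ℂ) • (D.sumFunctional _ h1 d - D.sumFunctional _ h2 d
        - Complex.I • D.sumFunctional _ h3 d + Complex.I • D.sumFunctional _ h4 d) := by
    intro d
    have hs := fun {ζ : ℕ → K} (hζ : Summable fun n => ‖ζ n‖ ^ 2) =>
      (summable_norm_inner_apply hζ hζ (d : K →L[ℂ] K)).of_norm.hasSum
    refine HasSum.tsum_eq (HasSum.congr_fun (((((hs h1).sub (hs h2)).sub
      ((hs h3).const_smul Complex.I)).add ((hs h4).const_smul Complex.I)).const_smul (4⁻¹ : ℂ))
      fun n => ?_)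
    have := LinearMap.congr_fun (sesquilinear_polarization D.vectorFunctional (η n) (ξ n)) d
    simp only [sub_eq_add_neg] at this ⊢
    exact this
  have hc := ((((hdiag _ h1).sub (hdiag _ h2)).sub ((hdiag _ h3).const_smul Complex.I)).add
    ((hdiag _ h4).const_smul Complex.I)).const_smul (4⁻¹ : ℂ)
  convert hc using 1
  ext x
  exact key (Ψ x)

open scoped ComplexOrder in
theorem isNormalPositive_of_extension (hΦ1 : Φ 1 = 1) (hΦ : HasUniqueStateExtension Φ)
    (hΨ : ∀ ξ, IsPositiveExtension Φ (D.vectorFunctional ξ ξ) (D.vectorFunctional ξ ξ ∘ₗ Ψ)) :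
    M.IsNormalPositive D Ψ where
  continuous := continuous_of_extension hΦ1 hΦ hΨ
  positive x hx := by
    have h : ∀ ξ, 0 ≤ inner ℂ ξ ((Ψ x : K →L[ℂ] K) ξ) := fun ξ =>
      Complex.nonneg_iff.2 ⟨(hΨ ξ).right.apply_nonneg hx,
        ((hΨ ξ).right.im_eq_zero hx.isSelfAdjoint).symm⟩
    rw [ContinuousLinearMap.isPositive_iff_complex]
    intro ξ
    have h1 := h ξ
    -- The positivity criterion has the operator in the first slot, hence the conjugation.
    rw [← inner_conj_symm, Complex.nonneg_iff, Complex.conj_re, Complex.conj_im] at h1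
    exact ⟨Complex.ext rfl (neg_eq_zero.1 h1.2.symm).symm, h1.1⟩

open scoped ComplexOrder in
/-- The pullback of a vector functional along a normal positive extension of `Φ` is the extension
of its pullback along `Φ`. -/
theorem IsNormalPositive.isPositiveExtension (hΨ : M.IsNormalPositive D Ψ)
    (hext : ∀ a : A, Ψ (a : M.toStarSubalgebra) = Φ a) (ξ : K) :
    IsPositiveExtension Φ (D.vectorFunctional ξ ξ) (D.vectorFunctional ξ ξ ∘ₗ Ψ) where
  left := D.isNormalPositiveFunctional_vectorFunctional ξ
  right := by
    refine isNormalPositiveFunctional_of_nonneg ?_ fun x hx => ?_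
    · exact @Continuous.comp _ _ _ M.weakStar D.weakStar _ _ _
        (D.isNormalPositiveFunctional_vectorFunctional ξ).continuous hΨ.continuous
    · have h := ((ContinuousLinearMap.isPositive_iff_complex _).1 (hΨ.positive x hx)) ξ
      change 0 ≤ inner ℂ ξ ((Ψ x : K →L[ℂ] K) ξ)
      rw [← inner_conj_symm, ← h.1]
      simpa using h.2
  apply_eq a := by simp [hext]

theorem existsUnique_isNormalPositive (hΦ1 : Φ 1 = 1) (hΦ : HasUniqueStateExtension Φ) :
    ∃! Ψ : M.toStarSubalgebra →ₗ[ℂ] D.toStarSubalgebra,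
      M.IsNormalPositive D Ψ ∧ ∀ a : A, Ψ (a : M.toStarSubalgebra) = Φ a := by
  obtain ⟨Ψ, hΨ⟩ := exists_dual_map hΦ1 hΦ
  have hΨ' := fun ξ => isPositiveExtension_form hΦ1 hΦ (hΨ ξ ξ)
  have hext : ∀ a : A, Ψ (a : M.toStarSubalgebra) = Φ a := by
    intro a
    ext ξ
    exact ext_inner_left ℂ fun η => apply_eq_of_mem_extensionGraph (hΨ η ξ) a
  refine ⟨Ψ, ⟨isNormalPositive_of_extension hΦ1 hΦ hΨ', hext⟩, ?_⟩
  rintro Ψ₁ ⟨h1, h1ext⟩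
  ext x ξ
  -- Both maps pull a diagonal vector functional back to its only positive extension; polarization
  -- then handles the off-diagonal ones.
  have hdiag : ∀ ζ, D.vectorFunctional ζ ζ (Ψ₁ x) = D.vectorFunctional ζ ζ (Ψ x) := fun ζ =>
    LinearMap.congr_fun ((h1.isPositiveExtension h1ext ζ).unique hΦ1 hΦ (hΨ' ζ)) x
  refine ext_inner_left ℂ fun η => ?_
  change D.vectorFunctional η ξ (Ψ₁ x) = D.vectorFunctional η ξ (Ψ x)
  rw [sesquilinear_polarization]
  simp only [LinearMap.smul_apply, LinearMap.add_apply, LinearMap.sub_apply, hdiag]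

end Extension

end VonNeumannAlgebra

theorem mainTheorem10
    {H : Type*} [NormedAddCommGroup H] [InnerProductSpace ℂ H] [CompleteSpace H]
    {K : Type*} [NormedAddCommGroup K] [InnerProductSpace ℂ K] [CompleteSpace K]
    (M : VonNeumannAlgebra H) (D : VonNeumannAlgebra K)
    (A : Subalgebra ℂ M.toStarSubalgebra)
    (hA : IsClosed[M.weakStar] (A : Set M.toStarSubalgebra))
    (Φ : A →ₗ[ℂ] D.toStarSubalgebra)
    (hΦ_one : Φ 1 = 1)
    (hΦ_contractive : ∀ a : A,
      ‖(Φ a : K →L[ℂ] K)‖ ≤ ‖((a : M.toStarSubalgebra) : H →L[ℂ] H)‖)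
    (hΦ_continuous : Continuous[M.weakStarOn A, D.weakStar] Φ)
    (hGW : ∀ φ : D.toStarSubalgebra →ₗ[ℂ] ℂ, D.IsNormalState φ →
      ∃! ψ : M.toStarSubalgebra →ₗ[ℂ] ℂ,
        M.IsNormalState ψ ∧ ∀ a : A, ψ (a : M.toStarSubalgebra) = φ (Φ a)) :
    ∃! Ψ : M.toStarSubalgebra →ₗ[ℂ] D.toStarSubalgebra,
      M.IsNormalPositive D Ψ ∧ ∀ a : A, Ψ (a : M.toStarSubalgebra) = Φ a :=
  VonNeumannAlgebra.existsUnique_isNormalPositive hΦ_one hGW
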